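/- Let $A\in \mathrm{M}_n(\mathbb Z)$ be non-singular with characteristic polynomial $h_A\in\mathbb Z[x]$. Let $G_A=\{A^k\mathbf x \mid \mathbf x\in\mathbb Z^n,\ k\in\mathbb Z\}\subseteq\mathbb Q^n$ (column vectors), let $\mathcal R=\mathbb Z[1/\det A]=\{k/(\det A)^l\mid k,l\in\mathbb Z\}$, let $\mathcal P$ be the set of primes dividing $\det A$, and let $\mathcal P'$ be the set of $p\in\mathcal P$ with $h_A\not\equiv x^n \pmod p$. For a prime $p$ let $t_p$ be the multiplicity of $0$ as a root of $h_A$ modulo $p$. For $\mathbf x=(x_1,\dots,x_n)\in\mathbb Z_p^n$ put $p^{-\infty}\mathbf x=\{p^{-k}\mathbf x^{(k)}\mid k\in\mathbb N\}\subset\mathbb Q^n$, where $\mathbf x^{(k)}=(x_1^{(k)},\dots,x_n^{(k)})\in\mathbb Z^n$ and $a^{(k)}=a_0+a_1p+\cdots+a_{k-1}p^{k-1}$ for $a=\sum_{i\ge 0}a_ip^i\in\mathbb Z_p$, $a_i\in\{0,\dots,p-1\}$. A family $\{\alpha_{pij}\in\mathbb Z_p \mid p\in\mathcal P',\ 1\le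 i\le t_p<j\le n\}$ is called a characteristic of $G_A$ relative to an ordered basis $\{\mathbf f_1,\dots,\mathbf f_n\}$ of $\mathbb Z^n$ if $G_A$ is generated, as an abelian group, by the vectors $\mathbf f_1,\dots,\mathbf f_n$ together with the elements of the sets $q^{-\infty}\mathbf f_i$ ($q\in\mathcal P\setminus\mathcal P'$, $1\le i\le n$) and $p^{-\infty}\mathbf x_{pi}$ ($p\in\mathcal P'$, $1\le i\le t_p$), where $\mathbf x_{pi}=\mathbf f_i+\sum_{j=t_p+1}^n\alpha_{pij}\mathbf f_j$. Theorem. Assume $\mathcal P'\neq\emptyset$, let $F$ be a number field containing all the eigenvalues of $A$, with ring of integers $\mathcal O_F$, and assume that $\{\alpha_{pij}\}$ is a characteristic of $G_A$ relative to the standard basis $\{\mathbf e_1,\dots,\mathbf e_n\}$. For a prime ideal $\mathfrak p$ of $\mathcal O_F$ let $\mathcal X_{A,\mathfrak p}\subseteq F^n$ be the span over $F$ of the generalized eigenvectors of $A$ corresponding to eigenvalues divisible by $\mathfrak p$. Then a matrix $T=(\gamma_{ij})\in \mathrm{M}_n(\mathbb Q)$ satisfies $T(G_A)\subseteq G_A$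 if and only if the following three conditions hold: 1. $T\in \mathrm{M}_n(\mathcal R)$; 2. $T(\mathcal X_{A,\mathfrak p})\subseteq\mathcal X_{A,\mathfrak p}$ for every $p\in\mathcal P'$ and every prime ideal $\mathfrak p$ of $\mathcal O_F$ above $p$; 3. for every $p\in\mathcal P'$ and all $j,k\in\{t_p+1,\dots,n\}$, $$\gamma_{kj}-\sum_{i=1}^{t_p}\gamma_{ij}\,\alpha_{pik}\in\mathbb Z_p .$$ -/

import Mathlib

namespace IntMat

open Polynomial
open scoped NumberField

variable {n : ℕ}

instance factPrime (p : Nat.Primes) : Fact (Nat.Prime (p : ℕ)) := ⟨p.2⟩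

/-- The group `G_A = {A ^ k x | x ∈ ℤⁿ, k ∈ ℤ}`, as a subset of `ℚⁿ` (columns). -/
def G (A : Matrix (Fin n) (Fin n) ℤ) : Set (Fin n → ℚ) :=
  {v | ∃ (k : ℤ) (x : Fin n → ℤ),
    v = ((A.map (Int.cast : ℤ → ℚ)) ^ k).mulVec (fun i => (x i : ℚ))}

/-- The ring `ℛ = ℤ[1 / det A] = {k / (det A) ^ l | k, l ∈ ℤ}`, as a subset of `ℚ`. -/
def R (A : Matrix (Fin n) (Fin n) ℤ) : Set ℚ :=
  {x | ∃ k l : ℤ, x = (k : ℚ) / (A.det : ℚ) ^ l}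

/-- The set `𝒫` of primes dividing `det A`. -/
def P (A : Matrix (Fin n) (Fin n) ℤ) : Set Nat.Primes :=
  {p | ((p : ℕ) : ℤ) ∣ A.det}

/-- The reduction modulo `p` of the characteristic polynomial of `A`. -/
noncomputable def charpolyMod (A : Matrix (Fin n) (Fin n) ℤ) (p : Nat.Primes) :
    (ZMod (p : ℕ))[X] :=
  A.charpoly.map (Int.castRingHom (ZMod (p : ℕ)))

/-- The set `𝒫'` of those `p ∈ 𝒫` for which the characteristic polynomial of `A` is not congruent
to `x ^ n` modulo `p`. -/
def P' (A : Matrix (Fin n) (Fin n) ℤ) : Set Nat.Primes :=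
  {p | p ∈ P A ∧ charpolyMod A p ≠ X ^ n}

/-- `t_p`: the multiplicity of zero in the reduction of the characteristic polynomial modulo `p`. -/
noncomputable def t (A : Matrix (Fin n) (Fin n) ℤ) (p : Nat.Primes) : ℕ :=
  (charpolyMod A p).rootMultiplicity 0

/-- `p ^ (-∞) x = {p ^ (-k) x ^ (k) | k ∈ ℕ}` for `x ∈ ℤ_pⁿ`. Here the truncation
`x ^ (k)` is taken coordinatewise, and `PadicInt.appr a k = a₀ + a₁ p + ⋯ + a_{k-1} p ^ (k-1)` is
the truncated digit expansion of `a ∈ ℤ_p`. -/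
def negInfty (p : Nat.Primes) (x : Fin n → ℤ_[(p : ℕ)]) : Set (Fin n → ℚ) :=
  {v | ∃ k : ℕ, v = fun i => ((x i).appr k : ℚ) / ((p : ℕ) : ℚ) ^ k}

/-- An integral vector seen in `ℤ_pⁿ`. -/
noncomputable def toPadic (p : Nat.Primes) (x : Fin n → ℤ) : Fin n → ℤ_[(p : ℕ)] :=
  fun i => (x i : ℤ_[(p : ℕ)])

/-- `x_{pi} = f_i + ∑_{j > t_p} α_{pij} f_j ∈ ℤ_pⁿ`. Indices start at zero: the ranges
`1 ≤ i ≤ t_p` and `t_p < j ≤ n` read `i < t_p` and `t_p ≤ j < n`. -/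
noncomputable def xVec (A : Matrix (Fin n) (Fin n) ℤ)
    (f : Module.Basis (Fin n) ℤ (Fin n → ℤ))
    (α : ∀ p : Nat.Primes, Fin n → Fin n → ℤ_[(p : ℕ)]) (p : Nat.Primes) (i : Fin n) :
    Fin n → ℤ_[(p : ℕ)] :=
  toPadic p (f i) + ∑ j : Fin n with t A p ≤ j.val, α p i j • toPadic p (f j)

/-- The family `α_{pij}` (only its values with `p ∈ 𝒫'` and `i ≤ t_p < j`, indices starting at
one, play a role) is a characteristic of `G_A` relative to the ordered basis `f` of `ℤⁿ`: the group
`G_A` is generated by `f_i`, `q ^ (-∞) f_i` for `q ∈ 𝒫 \ 𝒫'`, and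
`p ^ (-∞) x_{pi}` for `p ∈ 𝒫'`, `i ≤ t_p`. -/
def IsCharacteristic (A : Matrix (Fin n) (Fin n) ℤ)
    (f : Module.Basis (Fin n) ℤ (Fin n → ℤ))
    (α : ∀ p : Nat.Primes, Fin n → Fin n → ℤ_[(p : ℕ)]) : Prop :=
  G A = (AddSubgroup.closure
    ({v | ∃ i : Fin n, v = fun k => (f i k : ℚ)} ∪
      {v | ∃ q ∈ P A \ P' A, ∃ i : Fin n, v ∈ negInfty q (toPadic q (f i))} ∪
      {v | ∃ p ∈ P' A, ∃ i : Fin n, i.val < t A p ∧ v ∈ negInfty p (xVec A f α p i)}) :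
    Set (Fin n → ℚ))

/-- `𝒳_{A,𝔭}`: the span over `F` of the generalized eigenvectors of `A` for the eigenvalues
divisible by `𝔭` (all eigenvalues in `F` are algebraic integers; for `μ` not an eigenvalue the
generalized eigenspace is zero). -/
def eigenSpan (F : Type*) [Field F] [NumberField F] (A : Matrix (Fin n) (Fin n) ℤ)
    (𝔭 : Ideal (𝓞 F)) : Submodule F (Fin n → F) :=
  Submodule.span F {v | ∃ μ : 𝓞 F, μ ∈ 𝔭 ∧
    v ∈ Module.End.maxGenEigenspace (Matrix.toLin' (A.map (Int.cast : ℤ → F))) (μ : F)}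

end IntMat

/-! Since `A` is non-singular and integral, `G A` consists of the `v ∈ ℚⁿ` with `A ^ k v ∈ ℤⁿ` for
some natural `k`. This description makes sense over any ring: for a prime `𝔭` of `𝓞 F` with
valuation ring `O`, let `M` be the `O`-module of the `v ∈ Fⁿ` with `A ^ k v ∈ Oⁿ` for some `k`. Over
`O` the characteristic polynomial splits into two coprime factors, one with the roots divisible by
`𝔭` and one with the unit roots. On the first part `A` is topologically nilpotent, so every vector
is eventually integral; on the second `A` is invertible over `O`, so eventually integral means
integral. Hence `M = 𝒳 + Oⁿ` with `𝒳 = eigenSpan F A 𝔭`, and `𝒳` is the largest `F`-subspace of `M`.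

Necessity: the columns of `T` lie in `G A`, hence have entries in `ℛ`. As `M` is the `O`-span of `G
A`, `T` preserves `M` and so its largest subspace `𝒳`. Condition 3 is the integrality on the columns
of `T` of the functionals `padicFunctional`, which vanish on the `x_{pi}` and hence are integral on
`G A`.

Sufficiency: membership in `G A` is checked one prime `p` at a time. Away from `det A`, entries in
`ℛ` suffice; for `p ∈ 𝒫 \ 𝒫'`, `G A` is locally all of `ℚⁿ`. For `p ∈ 𝒫'` it is enough to show that
`T` preserves `M = 𝒳 + Oⁿ` for a single `𝔭` above `p`. Condition 2 handles `𝒳` and condition 3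
handles `e_j` with `j > t_p`. For `i ≤ t_p`, a truncation of `x_{pi}` is `𝔭`-adically close to `𝒳`,
so `T` sends it into `M`, and it differs from `e_i` by an integral combination of the `e_j` with `j
> t_p`. -/

namespace IntMat

open Polynomial

/-! ### Vectors moved into a stable lattice by a power of an endomorphism. -/

section EventualSubmodule

variable {O F V : Type*} [CommRing O] [Field F] [Algebra O F] [AddCommGroup V] [Module F V]
  [Module O V] [IsScalarTower O F V]

/-- The vectors that some power of `f` moves into the `f`-stable submodule `L`. -/
def eventualSubmodule (f : Module.End F V) (L : Submodule O V) (hL : ∀ v ∈ L, f v ∈ L) :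
    Submodule O V where
  carrier := {v | ∃ k : ℕ, (f ^ k) v ∈ L}
  zero_mem' := ⟨0, by simp⟩
  add_mem' := by
    have key : ∀ (k l : ℕ) (v : V), (f ^ k) v ∈ L → (f ^ (l + k)) v ∈ L := by
      intro k l v h
      induction l with
      | zero => simpa using h
      | succ l ih => rw [add_right_comm, pow_succ']; exact hL _ ih
    rintro v w ⟨k, hk⟩ ⟨l, hl⟩
    refine ⟨k + l, ?_⟩
    rw [map_add]
    exact L.add_mem (by rw [add_comm]; exact key k l v hk) (key l k w hl)
  smul_mem' := by
    rintro c v ⟨k, hk⟩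
    refine ⟨k, ?_⟩
    rw [← algebraMap_smul F c v, map_smul, algebraMap_smul]
    exact L.smul_mem c hk

variable {f : Module.End F V} {L : Submodule O V} {hL : ∀ v ∈ L, f v ∈ L}

theorem mem_eventualSubmodule {v : V} :
    v ∈ eventualSubmodule f L hL ↔ ∃ k : ℕ, (f ^ k) v ∈ L := Iff.rfl

theorem le_eventualSubmodule : L ≤ eventualSubmodule f L hL := fun v hv => ⟨0, by simpa using hv⟩

theorem mem_eventualSubmodule_of_pow {v : V} (k : ℕ)
    (h : (f ^ k) v ∈ eventualSubmodule f L hL) : v ∈ eventualSubmodule f L hL := by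
  obtain ⟨l, hl⟩ := h
  exact ⟨l + k, by rwa [pow_add]⟩

theorem aeval_mem_of_stable (hL : ∀ v ∈ L, f v ∈ L) (p : O[X]) {v : V} (hv : v ∈ L) :
    aeval f p v ∈ L := by
  induction p using Polynomial.induction_on' with
  | add p q hp hq => rw [map_add]; exact L.add_mem hp hq
  | monomial k a =>
    rw [aeval_monomial, Module.End.mul_apply, Module.algebraMap_end_apply]
    refine L.smul_mem a ?_
    induction k with
    | zero => simpa using hv
    | succ k ih => rw [pow_succ']; exact hL _ ih

/-- By induction on the exponent `m` of `f - μ` killing `v`: the vector `f ^ N v - μ ^ N v` is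
killed by a smaller power, and `μ ^ N v ∈ L` for suitable `N`, so `f ^ N v` is eventually in `L`. -/
theorem maxGenEigenspace_subset_eventualSubmodule {μ : O}
    (hμ : ∀ v : V, ∃ N : ℕ, μ ^ N • v ∈ L) {v : V}
    (hv : v ∈ f.maxGenEigenspace (algebraMap O F μ)) : v ∈ eventualSubmodule f L hL := by
  rw [Module.End.mem_maxGenEigenspace] at hv
  obtain ⟨m, hm⟩ := hv
  induction m generalizing v with
  | zero =>
    have : v = 0 := by simpa using hm
    rw [this]; exact zero_mem _
  | succ m ih =>
    set g := f - algebraMap O F μ • (1 : Module.End F V) with hg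
    have key : ∀ k : ℕ, (g ^ m) ((f ^ k) v - μ ^ k • v) = 0 := by
      have hcomm : ∀ k : ℕ, Commute (g ^ m) (f ^ k) := fun k =>
        Commute.pow_pow (((Commute.refl f).sub_left
          ((Commute.one_left f).smul_left _))) m k
      intro k
      induction k with
      | zero => simp
      | succ k ihk =>
        have e : (f ^ (k + 1)) v - μ ^ (k + 1) • v
            = (f ^ k) (g v) + μ • ((f ^ k) v - μ ^ k • v) := by
          rw [hg, LinearMap.sub_apply, LinearMap.smul_apply, Module.End.one_apply,
            algebraMap_smul, map_sub, pow_succ, Module.End.mul_apply, smul_sub, smul_smul,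
            ← pow_succ', ← algebraMap_smul F μ v, map_smul, algebraMap_smul]
          abel
        rw [e, map_add, ← Module.End.mul_apply, (hcomm k).eq, Module.End.mul_apply,
          ← Module.End.mul_apply (g ^ m) g v, ← pow_succ, hm, map_zero, zero_add,
          ← algebraMap_smul F μ, map_smul, ihk, smul_zero]
    obtain ⟨N, hN⟩ := hμ v
    refine mem_eventualSubmodule_of_pow N ?_
    have := add_mem (ih (key N)) (le_eventualSubmodule (hL := hL) hN)
    simpa using this

theorem span_maxGenEigenspace_subset_eventualSubmodule {s : Set O}
    (hs : ∀ μ ∈ s, ∀ v : V, ∃ N : ℕ, μ ^ N • v ∈ L) {v : V}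
    (hv : v ∈ Submodule.span F {v | ∃ μ ∈ s, v ∈ f.maxGenEigenspace (algebraMap O F μ)}) :
    v ∈ eventualSubmodule f L hL := by
  -- The span is over `F` while the target is only an `O`-module, so the induction carries all
  -- `F`-multiples.
  suffices ∀ c : F, c • v ∈ eventualSubmodule f L hL by simpa using this 1
  induction hv using Submodule.span_induction with
  | mem v h =>
    obtain ⟨μ, hμ, h⟩ := h
    exact fun c => maxGenEigenspace_subset_eventualSubmodule (hs μ hμ) (Submodule.smul_mem _ c h)
  | zero => simp
  | add v w _ _ hv hw => intro c; rw [smul_add]; exact add_mem (hv c) (hw c)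
  | smul a v _ hv => intro c; rw [smul_smul]; exact hv _

/-- If `f ^ k v ∈ L`, a Bézout relation `a h₁ X ^ k + b h₂ = 1` over `O` splits `v` into `b h₂ (f)
v`, killed by `h₁`, and a polynomial in `f` applied to `f ^ k v`, which stays in `L`. -/
theorem exists_aeval_eq_zero_sub_mem {h₁ h₂ : O[X]} (h12 : IsCoprime h₁ h₂)
    (hX : IsCoprime X h₂) (h0 : aeval f (h₁ * h₂) = 0) {v : V}
    (hv : v ∈ eventualSubmodule f L hL) : ∃ x, aeval f h₁ x = 0 ∧ v - x ∈ L := by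
  obtain ⟨k, hk⟩ := hv
  obtain ⟨a, b, hab⟩ := (h12.mul_left (hX.pow_left (m := k)))
  refine ⟨aeval f (b * h₂) v, ?_, ?_⟩
  · rw [← Module.End.mul_apply, ← map_mul, show h₁ * (b * h₂) = b * (h₁ * h₂) by ring, map_mul, h0]
    simp
  · have e : v = aeval f (a * h₁) ((f ^ k) v) + aeval f (b * h₂) v := by
      have := congrArg (fun q => aeval f q v) hab
      simpa [mul_assoc] using this.symm
    nth_rewrite 1 [e]
    rw [add_sub_cancel_right]
    exact aeval_mem_of_stable hL _ hk

/-- Let `y` be the component of `v` killed by `h₂`. On the kernel of `h₂` each power of `f` has an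
inverse that is a polynomial over `O` in `f`, so multiples of `y` that are eventually in `L` are
already in `L`. Thus the whole line `F y` lies in `L`, and `y = 0`. -/
theorem aeval_eq_zero_of_forall_smul_mem {h₁ h₂ : O[X]} (h12 : IsCoprime h₁ h₂)
    (hX : IsCoprime X h₂) (h0 : aeval f (h₁ * h₂) = 0)
    (hker : ∀ x, aeval f h₁ x = 0 → x ∈ eventualSubmodule f L hL)
    (hsep : ∀ v, (∀ c : F, c • v ∈ L) → v = 0) {v : V}
    (hv : ∀ c : F, c • v ∈ eventualSubmodule f L hL) : aeval f h₁ v = 0 := by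
  obtain ⟨a, b, hab⟩ := h12
  have e : v = aeval f (a * h₁) v + aeval f (b * h₂) v := by
    have := congrArg (fun q => aeval f q v) hab
    simpa using this.symm
  set x := aeval f (b * h₂) v
  set y := aeval f (a * h₁) v
  have hx : aeval f h₁ x = 0 := by
    rw [← Module.End.mul_apply, ← map_mul, show h₁ * (b * h₂) = b * (h₁ * h₂) by ring, map_mul, h0]
    simp
  have hy : aeval f h₂ y = 0 := by
    rw [← Module.End.mul_apply, ← map_mul, show h₂ * (a * h₁) = a * (h₁ * h₂) by ring, map_mul, h0]
    simp
  suffices y = 0 by rw [e, this, zero_add, hx]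
  refine hsep y fun c => ?_
  have hcy : c • y ∈ eventualSubmodule f L hL := by
    have h1 : c • y = c • v - c • x := by
      rw [← smul_sub]; congr 1; exact eq_sub_of_add_eq e.symm
    rw [h1]
    exact sub_mem (hv c) (hker _ (by rw [map_smul, hx, smul_zero]))
  obtain ⟨k, hk⟩ := hcy
  obtain ⟨a', b', hab'⟩ := hX.pow_left (m := k)
  have e' : c • y = aeval f a' ((f ^ k) (c • y)) := by
    have := congrArg (fun q => aeval f q (c • y)) hab'
    simp only [map_add, map_mul, map_pow, aeval_X, LinearMap.add_apply, Module.End.mul_apply,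
      map_one, Module.End.one_apply] at this
    rw [map_smul (aeval f h₂), hy, smul_zero, map_zero, add_zero] at this
    exact this.symm
  rw [e']
  exact aeval_mem_of_stable hL _ hk

end EventualSubmodule

theorem ker_aeval_prod_le {F V ι : Type*} [Field F] [AddCommGroup V] [Module F V]
    (f : Module.End F V) (s : Finset ι) (r : ι → F) (hr : Set.InjOn r s) (c : ι → ℕ)
    (E : Submodule F V) (hE : ∀ i ∈ s, f.maxGenEigenspace (r i) ≤ E) :
    LinearMap.ker (aeval f (∏ i ∈ s, (X - C (r i)) ^ c i)) ≤ E := by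
  classical
  induction s using Finset.induction_on with
  | empty => intro v hv; simp at hv; simp [hv]
  | insert i s hi ih =>
    rw [Finset.prod_insert hi, ← sup_ker_aeval_eq_ker_aeval_mul_of_coprime]
    · refine sup_le (le_trans ?_ (hE i (Finset.mem_insert_self i s)))
        (ih (hr.mono (by simp)) fun j hj => hE j (Finset.mem_insert_of_mem hj))
      intro v hv
      rw [Module.End.mem_maxGenEigenspace]
      refine ⟨c i, ?_⟩
      simpa [Algebra.algebraMap_eq_smul_one] using hv
    · refine IsCoprime.prod_right fun j hj => IsCoprime.pow (isCoprime_X_sub_C_of_isUnit_sub ?_)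
      refine (sub_ne_zero.mpr fun h => hi ?_).isUnit
      rw [hr (by simp) (by simp [hj]) h]; exact hj

/-! ### Splitting by non-unit and unit eigenvalues over a local ring. -/

section LocalRing

variable {O F V ι : Type*} [CommRing O] [IsLocalRing O] [Field F] [Algebra O F] [AddCommGroup V]
  [Module F V] [Module O V] [IsScalarTower O F V]
  {f : Module.End F V} {L : Submodule O V} {hL : ∀ v ∈ L, f v ∈ L}
  {s : Finset ι} {r : ι → O} {c : ι → ℕ} {E : Submodule F V}

open IsLocalRing

/-- `h₁` collects the roots in the maximal ideal and `h₂` the unit roots. A unit minus a non-unit is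
a unit in a local ring, so coprimality holds over `O` itself and not merely over `F`. -/
theorem exists_factors_of_isLocalRing (hr : Set.InjOn (fun i => algebraMap O F (r i)) s)
    (hf : aeval f (∏ i ∈ s, (X - C (r i)) ^ c i) = 0)
    (hE : ∀ i ∈ s, r i ∈ maximalIdeal O → f.maxGenEigenspace (algebraMap O F (r i)) ≤ E) :
    ∃ h₁ h₂ : O[X], IsCoprime h₁ h₂ ∧ IsCoprime X h₂ ∧ aeval f (h₁ * h₂) = 0 ∧
      ∀ v, aeval f h₁ v = 0 → v ∈ E := by
  classical
  refine ⟨∏ i ∈ s with r i ∈ maximalIdeal O, (X - C (r i)) ^ c i,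
    ∏ i ∈ s with r i ∉ maximalIdeal O, (X - C (r i)) ^ c i, ?_, ?_, ?_, ?_⟩
  · refine IsCoprime.prod_left fun i hi => IsCoprime.prod_right fun j hj =>
      IsCoprime.pow (isCoprime_X_sub_C_of_isUnit_sub ?_)
    rw [Finset.mem_filter] at hi hj
    by_contra h
    exact hj.2 (by simpa using sub_mem hi.2 ((mem_maximalIdeal _).mpr h))
  · refine IsCoprime.prod_right fun j hj => IsCoprime.pow_right ?_
    rw [Finset.mem_filter] at hj
    have : IsCoprime (X - C 0) (X - C (r j)) := by
      refine isCoprime_X_sub_C_of_isUnit_sub ?_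
      by_contra h
      exact hj.2 (by simpa using neg_mem ((mem_maximalIdeal _).mpr h))
    simpa using this
  · rwa [Finset.prod_filter_mul_prod_filter_not]
  · intro v hv
    refine ker_aeval_prod_le f (s.filter fun i => r i ∈ maximalIdeal O)
      (fun i => algebraMap O F (r i)) (hr.mono (Finset.coe_subset.mpr (Finset.filter_subset _ _))) c E
      (fun i hi => hE i (Finset.mem_filter.mp hi).1 (Finset.mem_filter.mp hi).2) ?_
    rw [← aeval_map_algebraMap F] at hv
    simpa [Polynomial.map_prod] using hv

theorem exists_sub_mem_of_mem_eventualSubmodule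
    (hr : Set.InjOn (fun i => algebraMap O F (r i)) s)
    (hf : aeval f (∏ i ∈ s, (X - C (r i)) ^ c i) = 0)
    (hE : ∀ i ∈ s, r i ∈ maximalIdeal O → f.maxGenEigenspace (algebraMap O F (r i)) ≤ E)
    {v : V} (hv : v ∈ eventualSubmodule f L hL) : ∃ x ∈ E, v - x ∈ L := by
  obtain ⟨h₁, h₂, h12, hX, h0, hker⟩ := exists_factors_of_isLocalRing hr hf hE
  obtain ⟨x, hx, hvx⟩ := exists_aeval_eq_zero_sub_mem h12 hX h0 hv
  exact ⟨x, hker x hx, hvx⟩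

theorem mem_of_forall_smul_mem_eventualSubmodule
    (hr : Set.InjOn (fun i => algebraMap O F (r i)) s)
    (hf : aeval f (∏ i ∈ s, (X - C (r i)) ^ c i) = 0)
    (hE : ∀ i ∈ s, r i ∈ maximalIdeal O → f.maxGenEigenspace (algebraMap O F (r i)) ≤ E)
    (hEM : ∀ v ∈ E, v ∈ eventualSubmodule f L hL)
    (hsep : ∀ v, (∀ c : F, c • v ∈ L) → v = 0) {v : V}
    (hv : ∀ c : F, c • v ∈ eventualSubmodule f L hL) : v ∈ E := by
  obtain ⟨h₁, h₂, h12, hX, h0, hker⟩ := exists_factors_of_isLocalRing hr hf hE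
  exact hker v (aeval_eq_zero_of_forall_smul_mem h12 hX h0 (fun x hx => hEM x (hker x hx)) hsep hv)

end LocalRing

end IntMat

/-! ### `G A` as the eventually integral vectors over `ℤ`; localization; the ring `ℛ`. -/

namespace IntMat

open Polynomial
open scoped NumberField
variable {n : ℕ}

section IntegralVectors

variable (O F : Type*) [CommRing O] [Field F] [Algebra O F]

/-- The vectors of `F ^ n` with coordinates in the image of `O`. -/
def integralVectors (n : ℕ) : Submodule O (Fin n → F) where
  carrier := {v | ∀ i, v i ∈ (algebraMap O F).range}
  zero_mem' := fun _ => zero_mem _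
  add_mem' := fun hv hw i => add_mem (hv i) (hw i)
  smul_mem' := fun c v hv i => by
    rw [Pi.smul_apply, Algebra.smul_def]
    exact mul_mem ⟨c, rfl⟩ (hv i)

variable {O F}

theorem mem_integralVectors {v : Fin n → F} :
    v ∈ integralVectors O F n ↔ ∀ i, v i ∈ (algebraMap O F).range := Iff.rfl

theorem intCast_mem_integralVectors (z : Fin n → ℤ) :
    (fun i => (z i : F)) ∈ integralVectors O F n := fun i => intCast_mem _ (z i)

theorem toLin'_intCast_mem_integralVectors (A : Matrix (Fin n) (Fin n) ℤ) (v : Fin n → F)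
    (hv : v ∈ integralVectors O F n) :
    Matrix.toLin' (A.map (Int.cast : ℤ → F)) v ∈ integralVectors O F n := by
  intro i
  rw [Matrix.toLin'_apply, Matrix.mulVec, dotProduct]
  exact sum_mem fun j _ => mul_mem (intCast_mem _ _) (hv j)

variable (O F)

/-- The vectors `v` of `F ^ n` such that some `A ^ k v` has coordinates in `O`. -/
def eventuallyIntegral (A : Matrix (Fin n) (Fin n) ℤ) : Submodule O (Fin n → F) :=
  eventualSubmodule (Matrix.toLin' (A.map (Int.cast : ℤ → F))) (integralVectors O F n)
    (toLin'_intCast_mem_integralVectors A)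

variable {O F}

theorem mem_eventuallyIntegral {A : Matrix (Fin n) (Fin n) ℤ} {v : Fin n → F} :
    v ∈ eventuallyIntegral O F A ↔
      ∃ k : ℕ, ((A.map (Int.cast : ℤ → F)) ^ k).mulVec v ∈ integralVectors O F n := by
  simp only [eventuallyIntegral, mem_eventualSubmodule, ← Matrix.toLin'_pow, Matrix.toLin'_apply]

theorem integralVectors_le_eventuallyIntegral (A : Matrix (Fin n) (Fin n) ℤ) :
    integralVectors O F n ≤ eventuallyIntegral O F A := le_eventualSubmodule

end IntegralVectors

theorem isUnit_det_intCast {F : Type*} [Field F] [CharZero F] {A : Matrix (Fin n) (Fin n) ℤ}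
    (hA : A.det ≠ 0) : IsUnit (A.map (Int.cast : ℤ → F)).det := by
  have : (A.map (Int.cast : ℤ → F)).det = (A.det : F) := ((Int.castRingHom F).map_det A).symm
  rw [this]
  exact (Int.cast_ne_zero.mpr hA).isUnit

/-- Nonnegative powers of `A` preserve `ℤⁿ`, so only the vectors `A ^ (-k) x` with `k ≥ 0` matter.
-/
theorem mem_G_iff {A : Matrix (Fin n) (Fin n) ℤ} (hA : A.det ≠ 0) {v : Fin n → ℚ} :
    v ∈ G A ↔ v ∈ eventuallyIntegral ℤ ℚ A := by
  have hu := isUnit_det_intCast (F := ℚ) hA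
  set B := A.map (Int.cast : ℤ → ℚ) with hB
  rw [mem_eventuallyIntegral, ← hB]
  constructor
  · rintro ⟨k, x, rfl⟩
    rw [← hB]
    obtain ⟨m, rfl | rfl⟩ := k.eq_nat_or_neg
    · refine ⟨0, ?_⟩
      rw [pow_zero, Matrix.one_mulVec, zpow_natCast]
      have : B ^ m = (A ^ m).map (Int.cast : ℤ → ℚ) := ((Int.castRingHom ℚ).mapMatrix.map_pow A m).symm
      rw [this]
      exact toLin'_intCast_mem_integralVectors (A ^ m) _ (intCast_mem_integralVectors x)
    · refine ⟨m, ?_⟩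
      rw [Matrix.mulVec_mulVec, ← zpow_natCast, ← Matrix.zpow_add hu, add_neg_cancel, zpow_zero,
        Matrix.one_mulVec]
      exact intCast_mem_integralVectors x
  · rintro ⟨k, hk⟩
    choose z hz using hk
    refine ⟨-(k : ℤ), z, ?_⟩
    have : (fun i => (z i : ℚ)) = (B ^ k).mulVec v := funext fun i => by simpa using hz i
    rw [this, ← hB, Matrix.mulVec_mulVec, ← zpow_natCast, ← Matrix.zpow_add hu, neg_add_cancel,
      zpow_zero, Matrix.one_mulVec]

/-- The integers `d` with `d • w ∈ E` form an ideal `(g)`. A prime dividing `g` would divide all of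
them, so `g` is a unit. -/
theorem mem_of_forall_prime_exists_smul_mem {M : Type*} [AddCommGroup M] (E : Submodule ℤ M)
    {w : M} (h : ∀ p : Nat.Primes, ∃ d : ℤ, ¬ ((p : ℕ) : ℤ) ∣ d ∧ d • w ∈ E) : w ∈ E := by
  obtain ⟨g, hg⟩ := (IsPrincipalIdealRing.principal
    (Submodule.comap (LinearMap.toSpanSingleton ℤ M w) E)).principal
  have hmem : ∀ d : ℤ, d • w ∈ E ↔ g ∣ d := fun d => by
    rw [← Ideal.mem_span_singleton, Ideal.span, ← hg]; simp
  by_cases h1 : g.natAbs = 1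
  · simpa using (hmem 1).mpr (by rw [← Int.natAbs_dvd, h1]; simp)
  · obtain ⟨p, hp, hpg⟩ := Nat.exists_prime_and_dvd h1
    obtain ⟨d, hpd, hd⟩ := h ⟨p, hp⟩
    exact absurd ((Int.natCast_dvd.mpr hpg).trans ((hmem d).mp hd)) hpd

theorem single_mem_integralVectors {O F : Type*} [CommRing O] [Field F] [Algebra O F] (j : Fin n) :
    Pi.single j 1 ∈ integralVectors O F n := by
  intro i
  by_cases h : i = j
  · subst h; simp
  · rw [Pi.single_eq_of_ne h]; exact zero_mem _

section R

variable (A : Matrix (Fin n) (Fin n) ℤ)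

theorem mem_R_iff (hA : A.det ≠ 0) {x : ℚ} :
    x ∈ R A ↔ ∃ (N : ℕ) (k : ℤ), (A.det : ℚ) ^ N * x = k := by
  have hd : (A.det : ℚ) ≠ 0 := Int.cast_ne_zero.mpr hA
  constructor
  · rintro ⟨k, l, rfl⟩
    obtain ⟨m, rfl | rfl⟩ := l.eq_nat_or_neg
    · exact ⟨m, k, by rw [zpow_natCast]; field_simp⟩
    · exact ⟨0, k * A.det ^ m, by rw [zpow_neg, zpow_natCast]; simp⟩
  · rintro ⟨N, k, h⟩
    exact ⟨k, N, by rw [zpow_natCast, ← h]; field_simp⟩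

/-- The ring `ℛ` as a subring of `ℚ`. -/
def subringR (hA : A.det ≠ 0) : Subring ℚ where
  carrier := R A
  zero_mem' := ⟨0, 0, by simp⟩
  one_mem' := ⟨1, 0, by simp⟩
  neg_mem' := by rintro _ ⟨k, l, rfl⟩; exact ⟨-k, l, by push_cast; ring⟩
  mul_mem' := by
    rintro _ _ ⟨k, l, rfl⟩ ⟨k', l', rfl⟩
    refine ⟨k * k', l + l', ?_⟩
    rw [zpow_add₀ (Int.cast_ne_zero.mpr hA)]
    push_cast
    rw [div_mul_div_comm]
  add_mem' := by
    intro x y hx hy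
    rw [mem_R_iff A hA] at *
    obtain ⟨N, k, h⟩ := hx
    obtain ⟨N', k', h'⟩ := hy
    refine ⟨N + N', A.det ^ N' * k + A.det ^ N * k', ?_⟩
    simp only [Int.cast_add, Int.cast_mul, Int.cast_pow]
    rw [← h, ← h']
    ring

variable {A}

/-- The entries of `A⁻¹ = adj A / det A` lie in `ℛ`, and `v` is a power of `A⁻¹` applied to an
integral vector. -/
theorem coord_mem_R_of_mem_G (hA : A.det ≠ 0) {v : Fin n → ℚ} (hv : v ∈ G A) (i : Fin n) :
    v i ∈ R A := by
  have hu := isUnit_det_intCast (F := ℚ) hA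
  rw [mem_G_iff hA, mem_eventuallyIntegral] at hv
  obtain ⟨k, hk⟩ := hv
  have hinv : ∀ i j, (A.map (Int.cast : ℤ → ℚ))⁻¹ i j ∈ subringR A hA := by
    intro i j
    have hdet : (A.map (Int.cast : ℤ → ℚ)).det = (A.det : ℚ) := ((Int.castRingHom ℚ).map_det A).symm
    have hadj : (A.map (Int.cast : ℤ → ℚ)).adjugate = A.adjugate.map (Int.cast : ℤ → ℚ) :=
      ((Int.castRingHom ℚ).map_adjugate A).symm
    rw [Matrix.inv_def, hdet, hadj, Ring.inverse_eq_inv']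
    exact ⟨A.adjugate i j, 1, by simp [div_eq_inv_mul]⟩
  have hpow : ∀ (m : ℕ) (w : Fin n → ℚ), (∀ i, w i ∈ subringR A hA) →
      ∀ i, (((A.map (Int.cast : ℤ → ℚ))⁻¹ ^ m).mulVec w) i ∈ subringR A hA := by
    intro m
    induction m with
    | zero => intro w hw i; simpa using hw i
    | succ m ih =>
      intro w hw
      rw [pow_succ, ← Matrix.mulVec_mulVec]
      refine ih _ fun i => ?_
      rw [Matrix.mulVec, dotProduct]
      exact sum_mem fun j _ => mul_mem (hinv i j) (hw j)
  have hv : v = ((A.map (Int.cast : ℤ → ℚ))⁻¹ ^ k).mulVec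
      (((A.map (Int.cast : ℤ → ℚ)) ^ k).mulVec v) := by
    rw [Matrix.mulVec_mulVec, Matrix.inv_pow', Matrix.nonsing_inv_mul, Matrix.one_mulVec]
    rw [Matrix.det_pow]; exact hu.pow k
  rw [hv]
  refine hpow k _ (fun i => ?_) i
  obtain ⟨z, hz⟩ := hk i
  rw [← hz]
  exact intCast_mem (subringR A hA) z

theorem exists_det_pow_smul_mem_integralVectors (hA : A.det ≠ 0) {v : Fin n → ℚ}
    (hv : ∀ i, v i ∈ R A) : ∃ N : ℕ, (A.det ^ N) • v ∈ integralVectors ℤ ℚ n := by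
  choose N k h using fun i => (mem_R_iff A hA).mp (hv i)
  refine ⟨∑ i, N i, fun i => ⟨A.det ^ (∑ j ∈ Finset.univ.erase i, N j) * k i, ?_⟩⟩
  rw [← Finset.add_sum_erase _ _ (Finset.mem_univ i), Pi.smul_apply, zsmul_eq_mul]
  simp only [algebraMap_int_eq, eq_intCast]
  simp only [Int.cast_mul, Int.cast_pow]
  rw [← h i]
  ring

end R

end IntMat

/-! ### The decomposition at a prime of the number field. -/

namespace IntMat

open Polynomial
open scoped NumberField
open IsDedekindDomain
variable {n : ℕ}

theorem exists_prod_eq_charpoly {F : Type*} [Field F] [CharZero F]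
    (A : Matrix (Fin n) (Fin n) ℤ)
    (hF : (A.charpoly.map (Int.castRingHom F)).Splits) :
    ∃ (s : Finset (𝓞 F)) (c : 𝓞 F → ℕ),
      (A.map (Int.cast : ℤ → F)).charpoly = ∏ i ∈ s, (X - C (i : F)) ^ c i := by
  classical
  set q := A.charpoly.map (Int.castRingHom F) with hq
  have hmonic : q.Monic := (Matrix.charpoly_monic A).map _
  refine ⟨q.roots.toFinset.preimage (algebraMap (𝓞 F) F)
    (NumberField.RingOfIntegers.coe_injective.injOn), fun i => q.roots.count (i : F), ?_⟩
  rw [Finset.prod_preimage (algebraMap (𝓞 F) F) q.roots.toFinset _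
    (fun x : F => (X - C x) ^ q.roots.count x)]
  · rw [← Finset.prod_multiset_map_count]
    exact (Matrix.charpoly_map A (Int.castRingHom F)).trans (hF.eq_prod_roots_of_monic hmonic)
  · intro x hx hx'
    refine absurd ?_ hx'
    rw [Multiset.mem_toFinset, mem_roots hmonic.ne_zero, IsRoot, hq, eval_map] at hx
    exact ⟨⟨x, A.charpoly, Matrix.charpoly_monic A, by
      rwa [show algebraMap ℤ F = Int.castRingHom F from RingHom.ext_int _ _]⟩, rfl⟩

section Local

variable {F : Type*} [Field F] [NumberField F] (w : HeightOneSpectrum (𝓞 F))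

theorem mem_range_valuationSubring_iff {x : F} :
    x ∈ (algebraMap (w.valuation F).valuationSubring F).range ↔ w.valuation F x ≤ 1 :=
  ⟨by rintro ⟨y, rfl⟩; exact y.2, fun h => ⟨⟨x, h⟩, rfl⟩⟩

theorem mem_integralVectors_valuationSubring_iff {v : Fin n → F} :
    v ∈ integralVectors (w.valuation F).valuationSubring F n ↔ ∀ i, w.valuation F (v i) ≤ 1 := by
  simp only [mem_integralVectors, mem_range_valuationSubring_iff]

theorem exists_forall_pow_mul_le_one {ι : Type*} [Finite ι] {y : F} (hy : w.valuation F y < 1)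
    (c : ι → F) : ∃ N : ℕ, ∀ m, N ≤ m → ∀ i, w.valuation F (y ^ m * c i) ≤ 1 := by
  have h1 : ∀ i, ∃ N : ℕ, ∀ m, N ≤ m → w.valuation F (y ^ m * c i) ≤ 1 := by
    intro i
    by_cases hc : c i = 0
    · exact ⟨0, fun m _ => by simp [hc]⟩
    have hc' : w.valuation F (c i) ≠ 0 := (Valuation.ne_zero_iff _).mpr hc
    obtain ⟨N, hN⟩ := exists_pow_lt₀ hy (Units.mk0 _ hc')⁻¹
    refine ⟨N, fun m hm => ?_⟩
    rw [map_mul, map_pow]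
    have h2 : w.valuation F y ^ m ≤ (w.valuation F (c i))⁻¹ :=
      (pow_le_pow_right_of_le_one' hy.le hm).trans (by simpa using hN.le)
    calc _ ≤ (w.valuation F (c i))⁻¹ * w.valuation F (c i) := by gcongr
      _ = 1 := inv_mul_cancel₀ hc'
  choose N hN using h1
  cases nonempty_fintype ι
  exact ⟨Finset.univ.sup N, fun m hm i =>
    hN i m ((Finset.le_sup (Finset.mem_univ i)).trans hm)⟩

theorem exists_pow_smul_mem_integralVectors (μ : (w.valuation F).valuationSubring)
    (hμ : w.valuation F μ < 1) (v : Fin n → F) :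
    ∃ N : ℕ, μ ^ N • v ∈ integralVectors (w.valuation F).valuationSubring F n := by
  obtain ⟨N, hN⟩ := exists_forall_pow_mul_le_one w hμ v
  refine ⟨N, (mem_integralVectors_valuationSubring_iff w).mpr fun i => ?_⟩
  simpa [Algebra.smul_def] using hN N le_rfl i

theorem eq_zero_of_forall_smul_mem_integralVectors (v : Fin n → F)
    (hv : ∀ c : F, c • v ∈ integralVectors (w.valuation F).valuationSubring F n) : v = 0 := by
  ext i
  by_contra hi
  obtain ⟨π, hπ⟩ := w.valuation_exists_uniformizer F
  have h0 : w.valuation F π ≠ 0 := by rw [hπ]; exact WithZero.coe_ne_zero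
  have h1 : w.valuation F π < 1 := by rw [hπ, ← WithZero.exp_zero, WithZero.exp_lt_exp]; decide
  -- This scalar turns the nonzero coordinate `v i` into `π⁻¹`, which is not integral.
  have := (mem_integralVectors_valuationSubring_iff w).mp (hv (π⁻¹ * (v i)⁻¹)) i
  rw [Pi.smul_apply, smul_eq_mul, mul_assoc, inv_mul_cancel₀ hi, mul_one, map_inv₀] at this
  exact absurd h1 (not_lt.mpr ((inv_le_one₀ (zero_lt_iff.mpr h0)).mp this))

theorem valuation_lt_one_of_mem_maximalIdeal {μ : (w.valuation F).valuationSubring}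
    (hμ : μ ∈ IsLocalRing.maximalIdeal (w.valuation F).valuationSubring) :
    w.valuation F μ < 1 := by
  refine lt_of_le_of_ne μ.2 fun h => (IsLocalRing.mem_maximalIdeal _).mp hμ ?_
  have h0 : (μ : F) ≠ 0 := by rintro h0; simp [h0] at h
  refine IsUnit.of_mul_eq_one ⟨(μ : F)⁻¹, ?_⟩ (Subtype.ext (mul_inv_cancel₀ h0))
  rw [Valuation.mem_valuationSubring_iff, map_inv₀, h, inv_one]

variable (A : Matrix (Fin n) (Fin n) ℤ)

theorem eigenSpan_subset_eventuallyIntegral {v : Fin n → F} (hv : v ∈ eigenSpan F A w.asIdeal) :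
    v ∈ eventuallyIntegral (w.valuation F).valuationSubring F A := by
  refine span_maxGenEigenspace_subset_eventualSubmodule
    (s := {μ : (w.valuation F).valuationSubring | w.valuation F μ < 1})
    (fun μ hμ v => exists_pow_smul_mem_integralVectors w μ hμ v) (Submodule.span_mono ?_ hv)
  rintro v ⟨μ, hμ, h⟩
  exact ⟨⟨μ, w.valuation_le_one μ⟩, (w.valuation_lt_one_iff_mem μ).mpr hμ, h⟩

theorem exists_annihilating_prod
    (hF : (A.charpoly.map (Int.castRingHom F)).Splits) :
    ∃ (s : Finset (𝓞 F)) (r : 𝓞 F → (w.valuation F).valuationSubring) (c : 𝓞 F → ℕ),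
      Set.InjOn (fun i => algebraMap (w.valuation F).valuationSubring F (r i)) s ∧
      aeval (Matrix.toLin' (A.map (Int.cast : ℤ → F))) (∏ i ∈ s, (X - C (r i)) ^ c i) = 0 ∧
      ∀ i ∈ s, r i ∈ IsLocalRing.maximalIdeal (w.valuation F).valuationSubring →
        Module.End.maxGenEigenspace (Matrix.toLin' (A.map (Int.cast : ℤ → F)))
          (algebraMap (w.valuation F).valuationSubring F (r i)) ≤ eigenSpan F A w.asIdeal := by
  obtain ⟨s, c, h⟩ := exists_prod_eq_charpoly A hF
  refine ⟨s, fun i => ⟨i, w.valuation_le_one i⟩, c,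
    NumberField.RingOfIntegers.coe_injective.injOn, ?_, ?_⟩
  · rw [← aeval_map_algebraMap F, Polynomial.map_prod]
    have : aeval (Matrix.toLin' (A.map (Int.cast : ℤ → F)))
      (Matrix.toLin' (A.map (Int.cast : ℤ → F))).charpoly = 0 := LinearMap.aeval_self_charpoly _
    rw [Matrix.charpoly_toLin', h] at this
    simpa using this
  · intro i _ hi v hv
    exact Submodule.subset_span ⟨i, (w.valuation_lt_one_iff_mem i).mp
      (valuation_lt_one_of_mem_maximalIdeal w hi), hv⟩

/-- The decomposition `M = 𝒳 + Oⁿ` at the prime `w`. -/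
theorem exists_eigenSpan_sub_mem_integralVectors
    (hF : (A.charpoly.map (Int.castRingHom F)).Splits) {v : Fin n → F}
    (hv : v ∈ eventuallyIntegral (w.valuation F).valuationSubring F A) :
    ∃ x ∈ eigenSpan F A w.asIdeal,
      v - x ∈ integralVectors (w.valuation F).valuationSubring F n := by
  obtain ⟨s, r, c, hr, hf, hE⟩ := exists_annihilating_prod w A hF
  exact exists_sub_mem_of_mem_eventualSubmodule hr hf hE hv

/-- With the inclusion `𝒳 ⊆ M`, this characterizes `𝒳` as the largest `F`-subspace of `M`, with no
mention of eigenvalues. -/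
theorem mem_eigenSpan_of_forall_smul_mem
    (hF : (A.charpoly.map (Int.castRingHom F)).Splits) {v : Fin n → F}
    (hv : ∀ c : F, c • v ∈ eventuallyIntegral (w.valuation F).valuationSubring F A) :
    v ∈ eigenSpan F A w.asIdeal := by
  obtain ⟨s, r, c, hr, hf, hE⟩ := exists_annihilating_prod w A hF
  exact mem_of_forall_smul_mem_eventualSubmodule hr hf hE
    (fun v hv => eigenSpan_subset_eventuallyIntegral w A hv)
    (eq_zero_of_forall_smul_mem_integralVectors w) hv

end Local

end IntMat

/-! ### Passage between `ℚ` and the number field. -/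

namespace IntMat

open Polynomial
open scoped NumberField
open IsDedekindDomain
variable {n : ℕ}

theorem norm_ratCast_le_one_iff {p : ℕ} [Fact p.Prime] {q : ℚ} :
    ‖(q : ℚ_[p])‖ ≤ 1 ↔ ¬ p ∣ q.den := by
  refine ⟨fun h hd => ?_, Padic.norm_rat_le_one⟩
  have h1 := PadicInt.isUnit_iff.mp (PadicInt.isUnit_den q h)
  have h2 : ‖((q.den : ℤ) : ℤ_[p])‖ < 1 := by
    rw [PadicInt.norm_int_lt_one_iff_dvd]; exact_mod_cast hd
  rw [Int.cast_natCast, h1] at h2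
  exact lt_irrefl _ h2

theorem map_mulVec_comp {S T : Type*} [CommRing S] [CommRing T] (g : S →+* T)
    (M : Matrix (Fin n) (Fin n) S) (v : Fin n → S) :
    (M.map g).mulVec (g ∘ v) = g ∘ M.mulVec v :=
  funext fun i => (RingHom.map_mulVec g M v i).symm

theorem intCast_map_pow_mulVec_comp {S T : Type*} [CommRing S] [CommRing T] (g : S →+* T)
    (A : Matrix (Fin n) (Fin n) ℤ) (k : ℕ) (v : Fin n → S) :
    ((A.map (Int.cast : ℤ → T)) ^ k).mulVec (g ∘ v)
      = g ∘ ((A.map (Int.cast : ℤ → S)) ^ k).mulVec v := by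
  rw [← map_mulVec_comp]
  congr 1
  have : A.map (Int.cast : ℤ → T) = g.mapMatrix (A.map (Int.cast : ℤ → S)) := by
    ext i j; simp
  rw [this, ← map_pow]
  rfl

section Local

variable {F : Type*} [Field F] [NumberField F] {A : Matrix (Fin n) (Fin n) ℤ}

theorem comp_mem_eventuallyIntegral (O : Type*) [CommRing O] [Algebra O F] {v : Fin n → ℚ}
    (hv : v ∈ eventuallyIntegral ℤ ℚ A) : algebraMap ℚ F ∘ v ∈ eventuallyIntegral O F A := by
  rw [mem_eventuallyIntegral] at *
  obtain ⟨k, hk⟩ := hv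
  refine ⟨k, fun i => ?_⟩
  obtain ⟨z, hz⟩ := hk i
  rw [intCast_map_pow_mulVec_comp, Function.comp_apply, ← hz]
  simp

theorem smul_mem_eventuallyIntegral (w : HeightOneSpectrum (𝓞 F)) {x : F}
    (hx : w.valuation F x ≤ 1) {v : Fin n → F}
    (hv : v ∈ eventuallyIntegral (w.valuation F).valuationSubring F A) :
    x • v ∈ eventuallyIntegral (w.valuation F).valuationSubring F A :=
  Submodule.smul_mem _ (⟨x, hx⟩ : (w.valuation F).valuationSubring) hv

/-- The eventually integral vectors over `O` are spanned over `O` by those over `ℤ`. -/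
theorem mem_of_forall_mem_eventuallyIntegral {O : Type*} [CommRing O] [Algebra O F]
    (hA : A.det ≠ 0) (N : Submodule O (Fin n → F))
    (hN : ∀ g ∈ eventuallyIntegral ℤ ℚ A, algebraMap ℚ F ∘ g ∈ N) {v : Fin n → F}
    (hv : v ∈ eventuallyIntegral O F A) : v ∈ N := by
  obtain ⟨k, hk⟩ := mem_eventuallyIntegral.mp hv
  have hu := isUnit_det_intCast (F := ℚ) hA
  have huF := isUnit_det_intCast (F := F) hA
  choose o ho using hk
  -- The vectors `A ^ (-k) e_i` lie in `G A`, and the integral coordinates of `A ^ k v` are the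
  -- coefficients of `v` in them.
  set g : Fin n → Fin n → ℚ := fun i =>
    (((A.map (Int.cast : ℤ → ℚ)) ^ k)⁻¹).mulVec (Pi.single i 1) with hg
  have hgi : ∀ i, ((A.map (Int.cast : ℤ → ℚ)) ^ k).mulVec (g i) = Pi.single i 1 := fun i => by
    rw [hg, Matrix.mulVec_mulVec, Matrix.mul_nonsing_inv, Matrix.one_mulVec]
    rw [Matrix.det_pow]; exact hu.pow k
  have hgm : ∀ i, g i ∈ eventuallyIntegral ℤ ℚ A := fun i =>
    mem_eventuallyIntegral.mpr ⟨k, by rw [hgi]; exact single_mem_integralVectors i⟩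
  have : v = ∑ i, o i • (algebraMap ℚ F ∘ g i) := by
    have hinj : Function.Injective ((A.map (Int.cast : ℤ → F)) ^ k).mulVec :=
      Matrix.mulVec_injective_of_isUnit ((Matrix.isUnit_iff_isUnit_det _).mpr
        (by rw [Matrix.det_pow]; exact huF.pow k))
    refine hinj ?_
    rw [Matrix.mulVec_sum]
    ext l
    rw [Finset.sum_apply, ← ho l, Finset.sum_eq_single l]
    · rw [Matrix.mulVec_smul, intCast_map_pow_mulVec_comp, hgi, Pi.smul_apply, Algebra.smul_def]
      simp
    · intro i _ hi
      rw [Matrix.mulVec_smul, intCast_map_pow_mulVec_comp, hgi, Pi.smul_apply, Algebra.smul_def]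
      simp [Pi.single_eq_of_ne hi.symm]
    · simp
  rw [this]
  exact sum_mem fun i _ => N.smul_mem _ (hN _ (hgm i))

theorem mulVec_mem_eventuallyIntegral {O : Type*} [CommRing O] [Algebra O F] (hA : A.det ≠ 0)
    {T : Matrix (Fin n) (Fin n) ℚ}
    (hT : ∀ g ∈ eventuallyIntegral ℤ ℚ A, T.mulVec g ∈ eventuallyIntegral ℤ ℚ A) {v : Fin n → F}
    (hv : v ∈ eventuallyIntegral O F A) :
    (T.map (algebraMap ℚ F)).mulVec v ∈ eventuallyIntegral O F A := by
  refine mem_of_forall_mem_eventuallyIntegral hA ((eventuallyIntegral O F A).comap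
    ((Matrix.toLin' (T.map (algebraMap ℚ F))).restrictScalars O)) (fun g hg => ?_) hv
  rw [Submodule.mem_comap, LinearMap.restrictScalars_apply, Matrix.toLin'_apply, map_mulVec_comp]
  exact comp_mem_eventuallyIntegral O (hT g hg)

/-- `T` is `F`-linear and preserves `M`, so it sends each line of `𝒳` to `F`-multiples that remain
in `M`. -/
theorem mulVec_mem_eigenSpan (hA : A.det ≠ 0) (hF : (A.charpoly.map (Int.castRingHom F)).Splits)
    {T : Matrix (Fin n) (Fin n) ℚ}
    (hT : ∀ g ∈ eventuallyIntegral ℤ ℚ A, T.mulVec g ∈ eventuallyIntegral ℤ ℚ A)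
    (w : HeightOneSpectrum (𝓞 F)) {v : Fin n → F} (hv : v ∈ eigenSpan F A w.asIdeal) :
    (T.map (algebraMap ℚ F)).mulVec v ∈ eigenSpan F A w.asIdeal := by
  refine mem_eigenSpan_of_forall_smul_mem w A hF fun c => ?_
  rw [← Matrix.mulVec_smul]
  exact mulVec_mem_eventuallyIntegral hA hT
    (eigenSpan_subset_eventuallyIntegral w A (Submodule.smul_mem _ c hv))

variable (w : HeightOneSpectrum (𝓞 F)) (p : ℕ) [w.asIdeal.LiesOver (Ideal.span {(p : ℤ)})]

theorem valuation_intCast_lt_one_iff (z : ℤ) : w.valuation F (z : F) < 1 ↔ (p : ℤ) ∣ z := by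
  have h := w.valuation_lt_one_iff_mem (K := F) (algebraMap ℤ (𝓞 F) z)
  rw [← Ideal.mem_of_liesOver w.asIdeal (Ideal.span {(p : ℤ)}), Ideal.mem_span_singleton] at h
  simpa using h

theorem valuation_intCast_le_one (z : ℤ) : w.valuation F (z : F) ≤ 1 := by
  simpa using w.valuation_le_one (K := F) (algebraMap ℤ (𝓞 F) z)

theorem valuation_natCast_self_lt_one : w.valuation F (p : F) < 1 := by
  simpa using (valuation_intCast_lt_one_iff w p p).mpr dvd_rfl

theorem valuation_ratCast_le_one_iff (hp : p.Prime) (q : ℚ) :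
    w.valuation F (algebraMap ℚ F q) ≤ 1 ↔ ¬ p ∣ q.den := by
  have hmul : w.valuation F (algebraMap ℚ F q) * w.valuation F ((q.den : ℤ) : F)
      = w.valuation F ((q.num : ℤ) : F) := by
    rw [← map_mul]
    congr 1
    rw [eq_ratCast]
    exact_mod_cast congrArg (Rat.cast : ℚ → F) (Rat.mul_den_eq_num q)
  constructor
  · intro h hd
    have h1 : w.valuation F ((q.den : ℤ) : F) < 1 :=
      (valuation_intCast_lt_one_iff w p _).mpr (by exact_mod_cast hd)
    have h2 : w.valuation F ((q.num : ℤ) : F) < 1 := by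
      rw [← hmul]; exact (mul_le_of_le_one_left' h).trans_lt h1
    rw [valuation_intCast_lt_one_iff w p, Int.natCast_dvd] at h2
    exact hp.one_lt.ne' (Nat.dvd_one.mp (q.reduced ▸ Nat.dvd_gcd h2 hd))
  · intro hd
    have h1 : w.valuation F ((q.den : ℤ) : F) = 1 := by
      refine le_antisymm (valuation_intCast_le_one w _) (not_lt.mp ?_)
      rw [valuation_intCast_lt_one_iff w p]
      exact_mod_cast hd
    rw [h1, mul_one] at hmul
    rw [hmul]; exact valuation_intCast_le_one w _

theorem exists_smul_mem_of_comp_mem_eventuallyIntegral (hp : p.Prime) {v : Fin n → ℚ}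
    (hv : algebraMap ℚ F ∘ v ∈ eventuallyIntegral (w.valuation F).valuationSubring F A) :
    ∃ d : ℤ, ¬ (p : ℤ) ∣ d ∧ d • v ∈ eventuallyIntegral ℤ ℚ A := by
  obtain ⟨k, hk⟩ := mem_eventuallyIntegral.mp hv
  rw [intCast_map_pow_mulVec_comp, mem_integralVectors_valuationSubring_iff] at hk
  set y := ((A.map (Int.cast : ℤ → ℚ)) ^ k).mulVec v
  -- The coordinates of `y = A ^ k v` are rational and `𝔭`-integral, so their denominators are prime
  -- to `p`.
  refine ⟨∏ i, ((y i).den : ℤ), ?_, mem_eventuallyIntegral.mpr ⟨k, fun i => ?_⟩⟩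
  · rw [(Nat.prime_iff_prime_int.mp hp).dvd_finsetProd_iff]
    rintro ⟨i, _, hi⟩
    exact (valuation_ratCast_le_one_iff w p hp (y i)).mp (hk i) (by exact_mod_cast hi)
  · rw [← Finset.prod_erase_mul _ _ (Finset.mem_univ i), ← Int.cast_smul_eq_zsmul ℚ,
      Matrix.mulVec_smul, Pi.smul_apply, smul_eq_mul, Int.cast_mul, mul_assoc]
    refine mul_mem (intCast_mem _ _) ⟨(y i).num, ?_⟩
    change (((y i).num : ℤ) : ℚ) = ((y i).den : ℚ) * y i
    rw [mul_comm, Rat.mul_den_eq_num]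

end Local

end IntMat

/-! ### The `p`-adic functionals and their integrality on `G A`. -/

namespace IntMat

open Polynomial
open scoped NumberField
open IsDedekindDomain
variable {n : ℕ} {A : Matrix (Fin n) (Fin n) ℤ} {α : ∀ p : Nat.Primes, Fin n → Fin n → ℤ_[(p : ℕ)]}

theorem toPadic_basisFun_apply (p : Nat.Primes) (i l : Fin n) :
    toPadic p (Pi.basisFun ℤ (Fin n) i) l = if l = i then 1 else 0 := by
  simp [toPadic, Pi.single_apply]

theorem xVec_basisFun_apply (p : Nat.Primes) (i l : Fin n) :
    xVec A (Pi.basisFun ℤ (Fin n)) α p i l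
      = (if l = i then 1 else 0) + if t A p ≤ l.val then α p i l else 0 := by
  rw [xVec, Pi.add_apply, toPadic_basisFun_apply, Finset.sum_apply]
  simp only [Pi.smul_apply, toPadic_basisFun_apply, Finset.sum_filter, smul_eq_mul, mul_ite,
    mul_one, mul_zero]
  congr 1
  rw [Finset.sum_eq_single l (fun j _ hj => by simp [hj.symm]) (by simp)]
  simp

theorem appr_zero (p : Nat.Primes) (m : ℕ) : (0 : ℤ_[(p : ℕ)]).appr m = 0 := by
  have h := PadicInt.appr_spec m (0 : ℤ_[(p : ℕ)])
  rw [zero_sub, neg_mem_iff, Ideal.mem_span_singleton] at h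
  refine Nat.eq_zero_of_dvd_of_lt ?_ (PadicInt.appr_lt 0 m)
  rw [← Int.natCast_dvd_natCast, Nat.cast_pow]
  exact (PadicInt.pow_p_dvd_int_iff m _).mp (by exact_mod_cast h)

theorem appr_one (p : Nat.Primes) {m : ℕ} (hm : m ≠ 0) : (1 : ℤ_[(p : ℕ)]).appr m = 1 := by
  have h := PadicInt.appr_spec m (1 : ℤ_[(p : ℕ)])
  rw [Ideal.mem_span_singleton] at h
  have h1 : ((p ^ m : ℕ) : ℤ) ∣ 1 - (((1 : ℤ_[(p : ℕ)]).appr m : ℕ) : ℤ) := by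
    exact_mod_cast (PadicInt.pow_p_dvd_int_iff m _).mp (by exact_mod_cast h)
  have h2 := (Nat.modEq_iff_dvd.mpr h1)
  rw [Nat.ModEq, Nat.mod_eq_of_lt (PadicInt.appr_lt 1 m),
    Nat.mod_eq_of_lt (Nat.one_lt_pow hm p.2.one_lt)] at h2
  exact h2

theorem exists_sub_appr_eq_pow_mul (p : Nat.Primes) (x : ℤ_[(p : ℕ)]) (m : ℕ) :
    ∃ y : ℤ_[(p : ℕ)], (x : ℚ_[(p : ℕ)]) - (x.appr m : ℚ_[(p : ℕ)])
      = ((p : ℕ) : ℚ_[(p : ℕ)]) ^ m * (y : ℚ_[(p : ℕ)]) := by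
  obtain ⟨y, hy⟩ := Ideal.mem_span_singleton.mp (PadicInt.appr_spec m x)
  exact ⟨y, by exact_mod_cast congrArg (fun z : ℤ_[(p : ℕ)] => (z : ℚ_[(p : ℕ)])) hy⟩

/-- The functional `v ↦ v_k - ∑_{i ≤ t_p} v_i α_{pik}` on `ℚⁿ`, with values in `ℚ_p`. -/
noncomputable def padicFunctional (A : Matrix (Fin n) (Fin n) ℤ)
    (α : ∀ p : Nat.Primes, Fin n → Fin n → ℤ_[(p : ℕ)]) (p : Nat.Primes) (k : Fin n) :
    (Fin n → ℚ) →+ ℚ_[(p : ℕ)] where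
  toFun v := (v k : ℚ_[(p : ℕ)]) - ∑ i : Fin n with i.val < t A p,
    (v i : ℚ_[(p : ℕ)]) * (α p i k : ℚ_[(p : ℕ)])
  map_zero' := by simp
  map_add' v w := by
    simp only [Pi.add_apply, Rat.cast_add, add_mul, Finset.sum_add_distrib]
    ring

theorem padicFunctional_apply (p : Nat.Primes) (k : Fin n) (v : Fin n → ℚ) :
    padicFunctional A α p k v = (v k : ℚ_[(p : ℕ)]) - ∑ i : Fin n with i.val < t A p,
      (v i : ℚ_[(p : ℕ)]) * (α p i k : ℚ_[(p : ℕ)]) := rfl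

theorem padicFunctional_mem_of_norm_le_one (p : Nat.Primes) (k : Fin n) {v : Fin n → ℚ}
    (hv : ∀ l, ‖(v l : ℚ_[(p : ℕ)])‖ ≤ 1) :
    padicFunctional A α p k v ∈ PadicInt.subring (p : ℕ) :=
  sub_mem (hv k) (sum_mem fun i _ => mul_mem (hv i) (α p i k).2)

theorem norm_natCast_div_prime_pow_le_one {p q : Nat.Primes} (hqp : q ≠ p) (a m : ℕ) :
    ‖(((a : ℚ) / ((q : ℕ) : ℚ) ^ m : ℚ) : ℚ_[(p : ℕ)])‖ ≤ 1 := by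
  have h : ‖((q : ℕ) : ℚ_[(p : ℕ)])‖ = 1 := by
    rw [Padic.norm_natCast_eq_one_iff]
    exact (Nat.coprime_primes p.2 q.2).mpr fun h => hqp (Subtype.ext h.symm)
  push_cast
  rw [norm_div, norm_pow, h, one_pow, div_one]
  exact Padic.norm_int_le_one (p := p) a

/-- Generators not attached to `p` have `p`-integral coordinates. For those attached to `p`, write
`p ^ (-m) x ^ (m) = p ^ (-m) x - y` with `y` integral: the functional, extended to `ℚ_pⁿ`, vanishes
on `x = x_{pi}`, so only its integral value on `-y` remains. -/
theorem padicFunctional_mem_of_mem_G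
    (hα : IsCharacteristic A (Pi.basisFun ℤ (Fin n)) α) {p : Nat.Primes} (hp : p ∈ P' A)
    {k : Fin n} (hk : t A p ≤ k.val) {v : Fin n → ℚ} (hv : v ∈ G A) :
    padicFunctional A α p k v ∈ PadicInt.subring (p : ℕ) := by
  rw [hα, SetLike.mem_coe] at hv
  induction hv using AddSubgroup.closure_induction with
  | zero => rw [map_zero]; exact zero_mem _
  | add v w _ _ hv hw => rw [map_add]; exact add_mem hv hw
  | neg v _ hv => rw [map_neg]; exact neg_mem hv
  | mem v hv =>
    rcases hv with (⟨i, rfl⟩ | ⟨q, hq, i, m, rfl⟩) | ⟨q, hq, i, hi, m, rfl⟩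
    · refine padicFunctional_mem_of_norm_le_one p k fun l => ?_
      rw [Rat.cast_intCast]; exact Padic.norm_int_le_one _
    · by_cases hqp : q = p
      · subst hqp
        exact absurd hp hq.2
      · exact padicFunctional_mem_of_norm_le_one p k fun l =>
          norm_natCast_div_prime_pow_le_one hqp _ _
    · by_cases hqp : q = p
      · subst hqp
        set x := xVec A (Pi.basisFun ℤ (Fin n)) α q i with hx
        have hp0 : ((q : ℕ) : ℚ_[(q : ℕ)]) ^ m ≠ 0 := pow_ne_zero _ (by
          exact_mod_cast q.2.ne_zero)
        choose y hy using fun l => exists_sub_appr_eq_pow_mul q (x l) m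
        have e : ∀ l, ((((x l).appr m : ℚ) / ((q : ℕ) : ℚ) ^ m : ℚ) : ℚ_[(q : ℕ)])
            = x l / ((q : ℕ) : ℚ_[(q : ℕ)]) ^ m - y l := by
          intro l
          push_cast
          rw [eq_sub_iff_add_eq, div_add' _ _ _ hp0, mul_comm, ← hy l]
          congr 1
          ring
        have hik : k ≠ i := fun h => absurd hi (not_lt.mpr (h ▸ hk))
        have hxk : x k = α q i k := by rw [hx, xVec_basisFun_apply, if_neg hik, if_pos hk, zero_add]
        have hxi : ∑ l : Fin n with l.val < t A q, (x l : ℚ_[(q : ℕ)]) * (α q l k : ℚ_[(q : ℕ)])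
            = α q i k := by
          rw [Finset.sum_eq_single i]
          · rw [hx, xVec_basisFun_apply, if_pos rfl, if_neg (not_le.mpr hi)]; simp
          · intro l hl hli
            rw [hx, xVec_basisFun_apply, if_neg hli,
              if_neg (not_le.mpr (Finset.mem_filter.mp hl).2)]
            simp
          · intro h; simp [hi] at h
        have : padicFunctional A α q k (fun l => ((x l).appr m : ℚ) / ((q : ℕ) : ℚ) ^ m)
            = -((y k : ℚ_[(q : ℕ)]) - ∑ l : Fin n with l.val < t A q,
              (y l : ℚ_[(q : ℕ)]) * (α q l k : ℚ_[(q : ℕ)])) := by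
          rw [padicFunctional_apply]
          simp only [e, sub_mul, Finset.sum_sub_distrib, div_mul_eq_mul_div]
          rw [← Finset.sum_div, hxi, hxk]
          ring
        rw [this]
        exact neg_mem (sub_mem (y k).2 (sum_mem fun l _ => mul_mem (y l).2 (α q l k).2))
      · exact padicFunctional_mem_of_norm_le_one p k fun l =>
          norm_natCast_div_prime_pow_le_one hqp _ _

end IntMat

/-! ### Truncated vectors and sufficiency at each prime. -/

namespace IntMat

open Polynomial
open scoped NumberField
open IsDedekindDomain
variable {n : ℕ} {A : Matrix (Fin n) (Fin n) ℤ} {α : ∀ p : Nat.Primes, Fin n → Fin n → ℤ_[(p : ℕ)]}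

/-- The truncation `x_{pi} ^ (m)` for the standard basis. -/
noncomputable def apprVec (A : Matrix (Fin n) (Fin n) ℤ)
    (α : ∀ p : Nat.Primes, Fin n → Fin n → ℤ_[(p : ℕ)]) (p : Nat.Primes) (m : ℕ) (i : Fin n) :
    Fin n → ℚ := fun l => ((xVec A (Pi.basisFun ℤ (Fin n)) α p i l).appr m : ℚ)

theorem apprVec_of_lt {p : Nat.Primes} {m : ℕ} (hm : m ≠ 0) (i : Fin n) {l : Fin n}
    (hl : l.val < t A p) : apprVec A α p m i l = if l = i then 1 else 0 := by
  rw [apprVec, xVec_basisFun_apply, if_neg (not_le.mpr hl), add_zero]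
  split_ifs
  · rw [appr_one p hm, Nat.cast_one]
  · rw [appr_zero, Nat.cast_zero]

theorem apprVec_of_le {p : Nat.Primes} {m : ℕ} {i l : Fin n} (hi : i.val < t A p)
    (hl : t A p ≤ l.val) : apprVec A α p m i l = ((α p i l).appr m : ℚ) := by
  rw [apprVec, xVec_basisFun_apply, if_pos hl, if_neg (by rintro rfl; omega), zero_add]

/-- The truncations `x_{pi} ^ (m)`, `i ≤ t_p`, and the `e_k`, `k > t_p`, form a unitriangular basis.
The exponent must be nonzero since the truncation of `1` to no digits is `0`. -/
theorem eq_sum_apprVec_add_sum_single (p : Nat.Primes) {m : ℕ} (hm : m ≠ 0) (v : Fin n → ℚ) :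
    v = ∑ i : Fin n with i.val < t A p, v i • apprVec A α p m i
      + ∑ k : Fin n with t A p ≤ k.val,
        (v k - ∑ i : Fin n with i.val < t A p, v i * ((α p i k).appr m : ℚ)) •
          (Pi.single k 1 : Fin n → ℚ) := by
  ext l
  simp only [Pi.add_apply, Finset.sum_apply, Pi.smul_apply, smul_eq_mul]
  by_cases hl : l.val < t A p
  · rw [Finset.sum_eq_single l, Finset.sum_eq_zero]
    · rw [apprVec_of_lt hm l hl]; simp
    · intro k hk
      rw [Pi.single_eq_of_ne, mul_zero]
      exact fun h => absurd hl (not_lt.mpr (h ▸ (Finset.mem_filter.mp hk).2))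
    · intro i _ hi
      rw [apprVec_of_lt hm i hl, if_neg hi.symm, mul_zero]
    · intro h; simp [hl] at h
  · rw [not_lt] at hl
    rw [Finset.sum_eq_single (s := Finset.univ.filter fun k : Fin n => t A p ≤ k.val) l]
    · rw [Pi.single_eq_same, mul_one, ← sub_eq_iff_eq_add']
      congr 1
      exact Finset.sum_congr rfl fun i hi => by
        rw [apprVec_of_le (Finset.mem_filter.mp hi).2 hl]
    · intro k _ hk
      rw [Pi.single_eq_of_ne hk.symm, mul_zero]
    · intro h; simp [hl] at h

theorem inv_pow_smul_apprVec_mem_G (hα : IsCharacteristic A (Pi.basisFun ℤ (Fin n)) α)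
    {p : Nat.Primes} (hp : p ∈ P' A) {i : Fin n} (hi : i.val < t A p) (m : ℕ) :
    (((p : ℕ) : ℚ) ^ m)⁻¹ • apprVec A α p m i ∈ G A := by
  rw [hα]
  refine AddSubgroup.subset_closure (Or.inr ⟨p, hp, i, hi, m, ?_⟩)
  ext l
  rw [Pi.smul_apply, smul_eq_mul, inv_mul_eq_div, apprVec]

theorem inv_pow_smul_single_mem_G (hα : IsCharacteristic A (Pi.basisFun ℤ (Fin n)) α)
    {q : Nat.Primes} (hq : q ∈ P A \ P' A) (i : Fin n) {m : ℕ} (hm : m ≠ 0) :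
    (((q : ℕ) : ℚ) ^ m)⁻¹ • (Pi.single i 1 : Fin n → ℚ) ∈ G A := by
  rw [hα]
  refine AddSubgroup.subset_closure (Or.inl (Or.inr ⟨q, hq, i, m, ?_⟩))
  ext l
  rw [Pi.smul_apply, smul_eq_mul, inv_mul_eq_div, toPadic_basisFun_apply, Pi.single_apply]
  split_ifs
  · rw [appr_one q hm, Nat.cast_one]
  · rw [appr_zero, Nat.cast_zero]

/-- All `q ^ (-m) e_i` lie in `G A`, so only the part prime to `q` of a common denominator of `v`
has to be cleared. -/
theorem exists_smul_mem_of_mem_diff (hA : A.det ≠ 0)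
    (hα : IsCharacteristic A (Pi.basisFun ℤ (Fin n)) α)
    {q : Nat.Primes} (hq : q ∈ P A \ P' A) (v : Fin n → ℚ) :
    ∃ d : ℤ, ¬ ((q : ℕ) : ℤ) ∣ d ∧ d • v ∈ eventuallyIntegral ℤ ℚ A := by
  have hD : (∏ i, (v i).den) ≠ 0 := Finset.prod_ne_zero_iff.mpr fun i _ => (v i).den_ne_zero
  obtain ⟨a, d, hd, hDd⟩ := Nat.exists_eq_pow_mul_and_not_dvd hD (q : ℕ) q.2.one_lt.ne'
  refine ⟨d, by exact_mod_cast hd, ?_⟩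
  have hz : ∀ i, ∃ z : ℤ, (∏ i, (v i).den : ℕ) * v i = z := fun i => by
    refine ⟨(∏ j ∈ Finset.univ.erase i, (v j).den : ℕ) * (v i).num, ?_⟩
    rw [← Finset.prod_erase_mul _ _ (Finset.mem_univ i), Nat.cast_mul, mul_assoc,
      mul_comm ((v i).den : ℚ), Rat.mul_den_eq_num]
    push_cast; rfl
  choose z hz using hz
  have hq0 : ((q : ℕ) : ℚ) ≠ 0 := by exact_mod_cast q.2.ne_zero
  -- The exponent `a + 1` is nonzero even if `a = 0`; the factor `q` compensates for it.
  have : (d : ℤ) • v = ∑ i, (z i * (q : ℕ)) •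
      ((((q : ℕ) : ℚ) ^ (a + 1))⁻¹ • (Pi.single i 1 : Fin n → ℚ)) := by
    ext l
    rw [Finset.sum_apply, Finset.sum_eq_single l]
    · simp only [Pi.smul_apply, zsmul_eq_mul, smul_eq_mul, Pi.single_eq_same]
      push_cast
      rw [← hz l, hDd]
      push_cast
      field_simp
      ring
    · intro i _ hi
      simp [Pi.single_eq_of_ne hi.symm]
    · simp
  rw [this]
  exact sum_mem fun i _ => Submodule.smul_mem _ _
    ((mem_G_iff hA).mp (inv_pow_smul_single_mem_G hα hq i a.succ_ne_zero))

theorem exists_smul_mem_of_not_mem_P (hA : A.det ≠ 0) {p : Nat.Primes} (hp : p ∉ P A)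
    {v : Fin n → ℚ} (hv : ∀ i, v i ∈ R A) :
    ∃ d : ℤ, ¬ ((p : ℕ) : ℤ) ∣ d ∧ d • v ∈ eventuallyIntegral ℤ ℚ A := by
  obtain ⟨N, hN⟩ := exists_det_pow_smul_mem_integralVectors hA hv
  exact ⟨A.det ^ N, fun h => hp ((Nat.prime_iff_prime_int.mp p.2).dvd_of_dvd_pow h),
    integralVectors_le_eventuallyIntegral A hN⟩

section Local

variable {F : Type*} [Field F] [NumberField F] (w : HeightOneSpectrum (𝓞 F))

theorem comp_sum_smul_mem_eventuallyIntegral {ι : Type*} (s : Finset ι) (c : ι → ℚ)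
    (g : ι → Fin n → ℚ)
    (h : ∀ i ∈ s, algebraMap ℚ F (c i) • (algebraMap ℚ F ∘ g i) ∈
      eventuallyIntegral (w.valuation F).valuationSubring F A) :
    algebraMap ℚ F ∘ (∑ i ∈ s, c i • g i) ∈
      eventuallyIntegral (w.valuation F).valuationSubring F A := by
  have : algebraMap ℚ F ∘ (∑ i ∈ s, c i • g i)
      = ∑ i ∈ s, algebraMap ℚ F (c i) • (algebraMap ℚ F ∘ g i) := by
    ext l
    simp
  rw [this]
  exact sum_mem h

theorem comp_single (j : Fin n) :
    algebraMap ℚ F ∘ (Pi.single j 1 : Fin n → ℚ) = Pi.single j 1 := by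
  ext l
  by_cases h : l = j
  · subst h; simp
  · simp [Pi.single_eq_of_ne h]

/-- A local converse to `padicFunctional_mem_of_mem_G`. Expand `v` in the `p ^ (-m) x_{pi} ^ (m) ∈ G
A` and the `e_k`. For large `m` the coefficients `p ^ m v_i` are integral, and the coefficient of
`e_k` differs from the functional by an integral combination of them. That coefficient is rational,
so `p`-adic and `𝔭`-adic integrality agree. -/
theorem comp_mem_eventuallyIntegral_of_padicFunctional (hA : A.det ≠ 0)
    (hα : IsCharacteristic A (Pi.basisFun ℤ (Fin n)) α)
    {p : Nat.Primes} (hp : p ∈ P' A) [w.asIdeal.LiesOver (Ideal.span {((p : ℕ) : ℤ)})]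
    {v : Fin n → ℚ}
    (hv : ∀ k : Fin n, t A p ≤ k.val → padicFunctional A α p k v ∈ PadicInt.subring (p : ℕ)) :
    algebraMap ℚ F ∘ v ∈ eventuallyIntegral (w.valuation F).valuationSubring F A := by
  obtain ⟨N, hN⟩ := exists_forall_pow_mul_le_one w
    (valuation_natCast_self_lt_one w (p : ℕ)) (fun i => algebraMap ℚ F (v i))
  set m := N + 1
  have hm : m ≠ 0 := N.succ_ne_zero
  have hp0 : ((p : ℕ) : ℚ) ^ m ≠ 0 := pow_ne_zero _ (by exact_mod_cast p.2.ne_zero)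
  have hval : ∀ i, w.valuation F (algebraMap ℚ F (((p : ℕ) : ℚ) ^ m * v i)) ≤ 1 := fun i => by
    simpa using hN m (Nat.le_succ N) i
  have hadd : ∀ a b : Fin n → ℚ, algebraMap ℚ F ∘ (a + b)
      = algebraMap ℚ F ∘ a + algebraMap ℚ F ∘ b := fun a b => by ext l; simp
  rw [eq_sum_apprVec_add_sum_single (A := A) (α := α) p hm v, hadd]
  refine add_mem ?_ ?_
  · refine comp_sum_smul_mem_eventuallyIntegral w _ _ _ fun i hi => ?_
    have := smul_mem_eventuallyIntegral w (hval i) (comp_mem_eventuallyIntegral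
      (w.valuation F).valuationSubring ((mem_G_iff hA).mp
      (inv_pow_smul_apprVec_mem_G hα hp (Finset.mem_filter.mp hi).2 m)))
    convert this using 1
    ext l
    simp only [Pi.smul_apply, Function.comp_apply, smul_eq_mul, ← map_mul]
    congr 1
    field_simp
  · refine comp_sum_smul_mem_eventuallyIntegral w _ _ _ fun k hk => ?_
    rw [comp_single]
    refine smul_mem_eventuallyIntegral w ?_
      (integralVectors_le_eventuallyIntegral A (single_mem_integralVectors k))
    rw [valuation_ratCast_le_one_iff w (p : ℕ) p.2, ← norm_ratCast_le_one_iff]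
    choose y hy using fun i => exists_sub_appr_eq_pow_mul p (α p i k) m
    have e : ((v k - ∑ i : Fin n with i.val < t A p, v i * ((α p i k).appr m : ℚ) : ℚ) :
        ℚ_[(p : ℕ)]) = padicFunctional A α p k v + ∑ i : Fin n with i.val < t A p,
          ((((p : ℕ) : ℚ) ^ m * v i : ℚ) : ℚ_[(p : ℕ)]) * (y i : ℚ_[(p : ℕ)]) := by
      have e1 : ∀ i, ((((p : ℕ) : ℚ) ^ m * v i : ℚ) : ℚ_[(p : ℕ)]) * (y i : ℚ_[(p : ℕ)])
          = (v i : ℚ_[(p : ℕ)]) * (α p i k : ℚ_[(p : ℕ)])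
            - (v i : ℚ_[(p : ℕ)]) * ((α p i k).appr m : ℚ_[(p : ℕ)]) := by
        intro i
        rw [← mul_sub, hy i]
        push_cast
        ring
      simp only [e1, Finset.sum_sub_distrib]
      rw [padicFunctional_apply]
      push_cast
      ring
    rw [e]
    exact (PadicInt.subring (p : ℕ)).add_mem (hv k (Finset.mem_filter.mp hk).2)
      (sum_mem fun i _ => mul_mem (norm_ratCast_le_one_iff.mpr
        ((valuation_ratCast_le_one_iff w (p : ℕ) p.2 _).mp (hval i))) (y i).2)

/-- By `M = 𝒳 + Oⁿ` and condition 2, only the columns of `T` need to be placed in `M`: those with `j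
> t_p` by the functionals, the others by approximating `x_{pi}` by vectors of `𝒳`. -/
theorem mulVec_mem_eventuallyIntegral_of_padicFunctional (hA : A.det ≠ 0)
    (hF : (A.charpoly.map (Int.castRingHom F)).Splits)
    (hα : IsCharacteristic A (Pi.basisFun ℤ (Fin n)) α)
    {p : Nat.Primes} (hp : p ∈ P' A) [w.asIdeal.LiesOver (Ideal.span {((p : ℕ) : ℤ)})]
    {T : Matrix (Fin n) (Fin n) ℚ}
    (hX : ∀ v ∈ eigenSpan F A w.asIdeal,
      (T.map (algebraMap ℚ F)).mulVec v ∈ eigenSpan F A w.asIdeal)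
    (hT : ∀ j : Fin n, t A p ≤ j.val → ∀ k : Fin n, t A p ≤ k.val →
      padicFunctional A α p k (T.mulVec (Pi.single j 1)) ∈ PadicInt.subring (p : ℕ))
    {v : Fin n → F} (hv : v ∈ eventuallyIntegral (w.valuation F).valuationSubring F A) :
    (T.map (algebraMap ℚ F)).mulVec v ∈
      eventuallyIntegral (w.valuation F).valuationSubring F A := by
  set M := eventuallyIntegral (w.valuation F).valuationSubring F A with hM
  have hXM : ∀ x ∈ eigenSpan F A w.asIdeal, (T.map (algebraMap ℚ F)).mulVec x ∈ M :=
    fun x hx => eigenSpan_subset_eventuallyIntegral w A (hX x hx)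
  have hge : ∀ j : Fin n, t A p ≤ j.val →
      (T.map (algebraMap ℚ F)).mulVec (Pi.single j 1) ∈ M := fun j hj => by
    rw [← comp_single, map_mulVec_comp]
    exact comp_mem_eventuallyIntegral_of_padicFunctional w hA hα hp (hT j hj)
  have hlt : ∀ i : Fin n, i.val < t A p →
      (T.map (algebraMap ℚ F)).mulVec (Pi.single i 1) ∈ M := fun i hi => by
    -- The exponent makes `p ^ m T` integral at `𝔭`. Writing `p ^ (-m) x_{pi} ^ (m)` as `x` in `𝒳`
    -- plus an integral vector and multiplying by `p ^ m`, the error becomes harmless under `T`.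
    obtain ⟨N, hN⟩ := exists_forall_pow_mul_le_one w (valuation_natCast_self_lt_one w (p : ℕ))
      (fun ij : Fin n × Fin n => algebraMap ℚ F (T ij.1 ij.2))
    set m := N + 1
    have hm : m ≠ 0 := N.succ_ne_zero
    have hp0 : ((p : ℕ) : ℚ) ^ m ≠ 0 := pow_ne_zero _ (by exact_mod_cast p.2.ne_zero)
    obtain ⟨x, hx, hgx⟩ := exists_eigenSpan_sub_mem_integralVectors w A hF
      (comp_mem_eventuallyIntegral (w.valuation F).valuationSubring
        ((mem_G_iff hA).mp (inv_pow_smul_apprVec_mem_G hα hp hi m)))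
    set g := (((p : ℕ) : ℚ) ^ m)⁻¹ • apprVec A α p m i
    have hint : (((p : ℕ) : F) ^ m) • (T.map (algebraMap ℚ F)).mulVec (algebraMap ℚ F ∘ g - x)
        ∈ M := by
      refine integralVectors_le_eventuallyIntegral A fun l => ?_
      rw [Pi.smul_apply, Matrix.mulVec, dotProduct, Finset.smul_sum]
      refine sum_mem fun j _ => ?_
      rw [smul_eq_mul, ← mul_assoc]
      exact mul_mem ((mem_range_valuationSubring_iff w).mpr (hN m (Nat.le_succ N) (l, j))) (hgx j)
    have hu : (T.map (algebraMap ℚ F)).mulVec (algebraMap ℚ F ∘ apprVec A α p m i) ∈ M := by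
      have e : algebraMap ℚ F ∘ apprVec A α p m i
          = (((p : ℕ) : F) ^ m) • (algebraMap ℚ F ∘ g - x) + (((p : ℕ) : F) ^ m) • x := by
        rw [← smul_add, sub_add_cancel]
        ext l
        have : ((p : ℕ) : F) ^ m = algebraMap ℚ F (((p : ℕ) : ℚ) ^ m) := by simp
        simp only [this, Pi.smul_apply, Function.comp_apply, smul_eq_mul, ← map_mul, g]
        congr 1
        field_simp
      rw [e, Matrix.mulVec_add, Matrix.mulVec_smul]
      exact add_mem hint (hXM _ (Submodule.smul_mem _ _ hx))
    -- The truncation is `e_i` plus an integral combination of the `e_k`, `k > t_p`, whose images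
    -- are already in `M`.
    have e : (Pi.single i 1 : Fin n → F) = algebraMap ℚ F ∘ apprVec A α p m i
        - ∑ k : Fin n with t A p ≤ k.val, (((α p i k).appr m : ℕ) : F) • Pi.single k 1 := by
      ext l
      rw [Pi.sub_apply, Finset.sum_apply, Function.comp_apply]
      by_cases hl : l.val < t A p
      · rw [apprVec_of_lt hm i hl, Finset.sum_eq_zero]
        · rw [Pi.single_apply, sub_zero]; split_ifs <;> simp
        · intro k hk
          rw [Pi.smul_apply, Pi.single_eq_of_ne, smul_zero]
          exact fun h => absurd hl (not_lt.mpr (h ▸ (Finset.mem_filter.mp hk).2))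
      · rw [not_lt] at hl
        rw [apprVec_of_le hi hl, Finset.sum_eq_single l]
        · rw [Pi.single_eq_of_ne (by rintro rfl; omega)]; simp
        · intro k _ hk; rw [Pi.smul_apply, Pi.single_eq_of_ne hk.symm, smul_zero]
        · intro h; simp [hl] at h
    rw [e, Matrix.mulVec_sub, Matrix.mulVec_sum]
    refine sub_mem hu (sum_mem fun k hk => ?_)
    rw [Matrix.mulVec_smul]
    refine smul_mem_eventuallyIntegral w ?_ (hge k (Finset.mem_filter.mp hk).2)
    exact_mod_cast valuation_intCast_le_one w ((α p i k).appr m : ℤ)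
  obtain ⟨x, hx, hvx⟩ := exists_eigenSpan_sub_mem_integralVectors w A hF hv
  have e : v = x + ∑ j, (v - x) j • (Pi.single j 1 : Fin n → F) := by
    rw [← pi_eq_sum_univ' (v - x), add_sub_cancel]
  rw [e, Matrix.mulVec_add, Matrix.mulVec_sum]
  refine add_mem (hXM x hx) (sum_mem fun j _ => ?_)
  rw [Matrix.mulVec_smul]
  refine smul_mem_eventuallyIntegral w
    ((mem_integralVectors_valuationSubring_iff w).mp hvx j) ?_
  rcases lt_or_ge j.val (t A p) with h | h
  · exact hlt j h
  · exact hge j h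

end Local

theorem padicFunctional_mulVec_single (p : Nat.Primes) (k j : Fin n)
    (T : Matrix (Fin n) (Fin n) ℚ) :
    padicFunctional A α p k (T.mulVec (Pi.single j 1)) = (T k j : ℚ_[(p : ℕ)]) -
      ∑ i : Fin n with i.val < t A p, (T i j : ℚ_[(p : ℕ)]) * (α p i k : ℚ_[(p : ℕ)]) := by
  rw [padicFunctional_apply, Matrix.mulVec_single_one]
  rfl

theorem exists_heightOneSpectrum_of_mem_primesOver {F : Type*} [Field F] [NumberField F]
    {p : Nat.Primes} {𝔭 : Ideal (𝓞 F)}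
    (h𝔭 : 𝔭 ∈ Ideal.primesOver (Ideal.span {((p : ℕ) : ℤ)}) (𝓞 F)) :
    ∃ w : HeightOneSpectrum (𝓞 F), w.asIdeal = 𝔭 := by
  have := h𝔭.2
  refine ⟨⟨𝔭, h𝔭.1, Ideal.ne_bot_of_liesOver_of_ne_bot
    (p := Ideal.span {((p : ℕ) : ℤ)}) ?_ 𝔭⟩, rfl⟩
  rw [Ne, Ideal.span_singleton_eq_bot]
  exact_mod_cast p.2.ne_zero

end IntMat

/-! ### The main theorem. -/

open scoped NumberField in
theorem mainTheorem3 {n : ℕ} (A : Matrix (Fin n) (Fin n) ℤ) (hA : A.det ≠ 0)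
    (hP' : (IntMat.P' A).Nonempty)
    (F : Type*) [Field F] [NumberField F]
    (hF : (A.charpoly.map (Int.castRingHom F)).Splits)
    (α : ∀ p : Nat.Primes, Fin n → Fin n → ℤ_[(p : ℕ)])
    (hα : IntMat.IsCharacteristic A (Pi.basisFun ℤ (Fin n)) α)
    (T : Matrix (Fin n) (Fin n) ℚ) :
    (∀ v ∈ IntMat.G A, T.mulVec v ∈ IntMat.G A) ↔
      (∀ i j, T i j ∈ IntMat.R A) ∧
      (∀ p ∈ IntMat.P' A,
        ∀ 𝔭 ∈ Ideal.primesOver (Ideal.span {((p : ℕ) : ℤ)}) (𝓞 F),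
          ∀ v ∈ IntMat.eigenSpan F A 𝔭,
            (T.map (algebraMap ℚ F)).mulVec v ∈ IntMat.eigenSpan F A 𝔭) ∧
      (∀ p ∈ IntMat.P' A, ∀ j : Fin n, IntMat.t A p ≤ j.val →
        ∀ k : Fin n, IntMat.t A p ≤ k.val →
          (T k j : ℚ_[(p : ℕ)]) -
            ∑ i : Fin n with i.val < IntMat.t A p,
              (T i j : ℚ_[(p : ℕ)]) * (α p i k : ℚ_[(p : ℕ)])
            ∈ PadicInt.subring (p : ℕ)) := by
  have hT : (∀ v ∈ IntMat.G A, T.mulVec v ∈ IntMat.G A) ↔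
      ∀ v ∈ IntMat.eventuallyIntegral ℤ ℚ A, T.mulVec v ∈ IntMat.eventuallyIntegral ℤ ℚ A := by
    simp only [IntMat.mem_G_iff hA]
  simp only [← IntMat.padicFunctional_mulVec_single]
  constructor
  · intro h
    have hsingle : ∀ j : Fin n, T.mulVec (Pi.single j 1) ∈ IntMat.G A := fun j =>
      h _ ((IntMat.mem_G_iff hA).mpr (IntMat.integralVectors_le_eventuallyIntegral A
        (IntMat.single_mem_integralVectors j)))
    refine ⟨fun i j => ?_, fun p _ 𝔭 h𝔭 v hv => ?_, fun p hp j _ k hk =>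
      IntMat.padicFunctional_mem_of_mem_G hα hp hk (hsingle j)⟩
    · have := IntMat.coord_mem_R_of_mem_G hA (hsingle j) i
      rwa [Matrix.mulVec_single_one] at this
    · obtain ⟨w, rfl⟩ := IntMat.exists_heightOneSpectrum_of_mem_primesOver h𝔭
      exact IntMat.mulVec_mem_eigenSpan hA hF (hT.mp h) w hv
  · rintro ⟨h1, h2, h3⟩
    refine hT.mpr fun v hv => IntMat.mem_of_forall_prime_exists_smul_mem _ fun p => ?_
    by_cases hp' : p ∈ IntMat.P' A
    -- One prime above `p` is enough: for a rational vector, lying in `M` at any such prime already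
    -- gives membership in `G A` locally at `p`.
    · obtain ⟨𝔭, h𝔭⟩ := (Ideal.nonempty_primesOver (S := 𝓞 F)
        (Ideal.span {((p : ℕ) : ℤ)}))
      obtain ⟨w, rfl⟩ := IntMat.exists_heightOneSpectrum_of_mem_primesOver h𝔭
      have := h𝔭.2
      refine IntMat.exists_smul_mem_of_comp_mem_eventuallyIntegral (F := F) w (p : ℕ) p.2 ?_
      rw [← IntMat.map_mulVec_comp]
      exact IntMat.mulVec_mem_eventuallyIntegral_of_padicFunctional w hA hF hα hp'
        (h2 p hp' _ h𝔭) (h3 p hp') (IntMat.comp_mem_eventuallyIntegral _ hv)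
    · by_cases hp : p ∈ IntMat.P A
      · exact IntMat.exists_smul_mem_of_mem_diff hA hα ⟨hp, hp'⟩ _
      · refine IntMat.exists_smul_mem_of_not_mem_P hA hp fun i => ?_
        have hR := fun j => IntMat.coord_mem_R_of_mem_G hA ((IntMat.mem_G_iff hA).mpr hv) j
        rw [Matrix.mulVec, dotProduct]
        exact (IntMat.subringR A hA).sum_mem fun j _ =>
          (IntMat.subringR A hA).mul_mem (h1 i j) (hR j)
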